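/- Let $p$ be a prime and let $P$ be a finite $p$-group. Conventions. A category $\mathcal F$ on $P$ has the subgroups of $P$ as objects and, for $Q,R\le P$, a set $\mathrm{Hom}_{\mathcal F}(Q,R)$ of injective group homomorphisms $Q\to R$ as morphisms, composed as homomorphisms. Write $\mathrm{Aut}_P(Q)$ for the automorphisms of $Q$ induced by conjugation with elements of $P$. A subgroup $Q$ is fully $\mathcal F$-normalized if $|N_P(Q)|\ge |N_P(R)|$ for every $R\le P$ that is $\mathcal F$-isomorphic to $Q$. The category $\mathcal F$ is a saturated fusion system on $P$ if: (a) all inclusions $Q\le R$ are morphisms of $\mathcal F$; (b) for each $\phi\in\mathrm{Hom}_{\mathcal F}(Q,R)$ the induced isomorphism $Q\to\phi(Q)$ and its inverse are in $\mathcal F$; (c) all homomorphisms $Q\to R$ induced by conjugation with an element of $P$ are in $\mathcal F$; (d) $\mathrm{Aut}_P(P)$ is a Sylow $p$-subgroup of $\mathrm{Aut}_{\mathcal F}(P)$; (e) every $\phi\in\mathrm{Hom}_{\mathcal F}(Q,P)$ with $\phi(Q)$ fully $\mathcal F$-normalized extends to a morphism $N_\phi\to P$ in $\mathcal F$, where $N_\phi$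 is the inverse image in $N_P(Q)$ of $\mathrm{Aut}_P(Q)\cap\phi^{-1}\mathrm{Aut}_P(\phi(Q))\phi$. For a group $G$ containing $P$, $\mathcal F_P(G)$ is the category on $P$ whose morphisms $Q\to R$ are the homomorphisms induced by conjugation with elements of $G$. A saturated fusion system $\mathcal F$ on $P$ is extremely sparse if $\mathcal F\ne\mathcal F_P(P)$ and, for every subgroup $Q\le P$, every subcategory $\mathcal G\neq\mathcal F$ of $\mathcal F$ that is a saturated fusion system on $Q$ is equal to $\mathcal F_Q(Q)$. A subgroup $Q\le P$ is $\mathcal F$-essential if $C_P(R)\le R$ for every $R$ that is $\mathcal F$-isomorphic to $Q$, and $\mathrm{Out}_{\mathcal F}(Q)=\mathrm{Aut}_{\mathcal F}(Q)/\mathrm{Aut}_Q(Q)$ has a strongly $p$-embedded subgroup; here a proper subgroup $H$ of a finite group $G$ is strongly $p$-embedded if it contains a nontrivial Sylow $p$-subgroup $S$ of $G$ such that $H\cap S^x=1$ for all $x\in G\setminus H$. Theorem. Let $\mathcal F$ be a saturated fusion system on a finite $p$-group $P$. If $\mathcal F$ is extremely sparse, then no subgroup of $P$ is $\mathcal F$-essential,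 and there are a prime $q\ne p$, a cyclic group $A$ of order $q$ and an action of $A$ on $P$ by automorphisms such that $\mathcal F=\mathcal F_P(P\rtimes A)$. -/

import Mathlib

/-- A category whose objects are the subgroups of `P` and whose morphisms `Q → R` form a set of
injective group homomorphisms, composed as group homomorphisms. -/
@[ext]
structure FusionCategory (P : Type*) [Group P] where
  Hom : (Q R : Subgroup P) → Set (Q →* R)
  injective : ∀ {Q R : Subgroup P} {φ : Q →* R}, φ ∈ Hom Q R → Function.Injective φ
  id_mem : ∀ Q : Subgroup P, MonoidHom.id Q ∈ Hom Q Q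
  comp_mem : ∀ {Q R S : Subgroup P} {φ : Q →* R} {ψ : R →* S},
    φ ∈ Hom Q R → ψ ∈ Hom R S → ψ.comp φ ∈ Hom Q S

/-- For a group `G` containing `P` through the embedding `ι`, the category `F_P(G)`: the morphisms
`Q → R` are the homomorphisms induced by conjugation with an element of `G`. -/
def groupFusion {P G : Type*} [Group P] [Group G] (ι : P →* G) (hι : Function.Injective ι) :
    FusionCategory P where
  Hom Q R := {φ : Q →* R | ∃ g : G, ∀ x : Q, ι (φ x : P) = g * ι (x : P) * g⁻¹}
  injective := by
    rintro Q R φ ⟨g, hg⟩ x y hxy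
    have h := hg x
    rw [hxy, hg y] at h
    exact Subtype.ext (hι (mul_left_cancel (mul_right_cancel h))).symm
  id_mem Q := ⟨1, by simp⟩
  comp_mem := by
    rintro Q R S φ ψ ⟨g, hg⟩ ⟨h, hh⟩
    exact ⟨h * g, fun x => by simp [hh, hg, mul_assoc]⟩

/-- The trivial fusion system `F_P(P)`. -/
def trivialFusion (P : Type*) [Group P] : FusionCategory P :=
  groupFusion (MonoidHom.id P) Function.injective_id

/-- `H` is a strongly `p`-embedded subgroup of `G`. -/
def IsStronglyEmbedded (p : ℕ) {G : Type*} [Group G] (H : Subgroup G) : Prop :=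
  H ≠ ⊤ ∧ ∃ S : Sylow p G, (S : Subgroup G) ≠ ⊥ ∧ (S : Subgroup G) ≤ H ∧
    ∀ x : G, x ∉ H → H ⊓ (S : Subgroup G).map (MulAut.conj x⁻¹).toMonoidHom = ⊥

/-- The group `Inn(Q) = Aut_Q(Q)` of inner automorphisms. -/
def innerAut (Q : Type*) [Group Q] : Subgroup (MulAut Q) := (MulAut.conj : Q →* MulAut Q).range

instance innerAut_normal (Q : Type*) [Group Q] : (innerAut Q).Normal where
  conj_mem := by
    rintro _ ⟨x, rfl⟩ α
    refine ⟨α x, ?_⟩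
    ext y
    simp [MulAut.mul_apply]

namespace FusionCategory

variable {P : Type*} [Group P]

/-- `Q` and `R` are isomorphic in the category `F`. -/
def IsIso (F : FusionCategory P) (Q R : Subgroup P) : Prop :=
  ∃ e : Q ≃* R, e.toMonoidHom ∈ F.Hom Q R ∧ e.symm.toMonoidHom ∈ F.Hom R Q

/-- The automorphism group `Aut_F(Q)` of the object `Q` of `F`. -/
def aut (F : FusionCategory P) (Q : Subgroup P) : Subgroup (MulAut Q) where
  carrier := {α | MulEquiv.toMonoidHom α ∈ F.Hom Q Q ∧
    MulEquiv.toMonoidHom (MulEquiv.symm α) ∈ F.Hom Q Q}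
  one_mem' := ⟨F.id_mem Q, F.id_mem Q⟩
  mul_mem' := fun ha hb => ⟨F.comp_mem hb.1 ha.1, F.comp_mem ha.2 hb.2⟩
  inv_mem' := fun ha => ⟨ha.2, ha.1⟩

/-- The group `Aut_P(Q)` of automorphisms of `Q` induced by conjugation with elements of `P`. -/
def autP (Q : Subgroup P) : Subgroup (MulAut Q) := (trivialFusion P).aut Q

/-- `Out_F(Q) = Aut_F(Q) / Aut_Q(Q)`. -/
abbrev Out (F : FusionCategory P) (Q : Subgroup P) : Type _ :=
  F.aut Q ⧸ (innerAut Q).subgroupOf (F.aut Q)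

/-- `Q` is fully `F`-normalized. -/
def IsFullyNormalized (F : FusionCategory P) (Q : Subgroup P) : Prop :=
  ∀ R : Subgroup P, F.IsIso Q R →
    Nat.card (Subgroup.normalizer (R : Set P)) ≤ Nat.card (Subgroup.normalizer (Q : Set P))

/-- `Q` is `F`-centric. -/
def IsCentric (F : FusionCategory P) (Q : Subgroup P) : Prop :=
  ∀ R : Subgroup P, F.IsIso Q R → Subgroup.centralizer (R : Set P) ≤ R

/-- `Q` is `F`-essential. -/
def IsEssential (p : ℕ) (F : FusionCategory P) (Q : Subgroup P) : Prop :=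
  F.IsCentric Q ∧ ∃ H : Subgroup (F.Out Q), IsStronglyEmbedded p H

/-- The image `φ(Q)` as a subgroup of `P`. -/
def image {Q R : Subgroup P} (φ : Q →* R) : Subgroup P := (R.subtype.comp φ).range

/-- The subgroup `N_φ` of `N_P(Q)`: all `u ∈ N_P(Q)` for which `φ ∘ c_u ∘ φ⁻¹` is the restriction
to `φ(Q)` of conjugation `c_v` by some `v` in `P` (which then normalizes `φ(Q)`). -/
def extender {Q R : Subgroup P} (φ : Q →* R) : Subgroup P where
  carrier := {u | ∃ hu : u ∈ Subgroup.normalizer (Q : Set P), ∃ v : P, ∀ x : Q,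
    (φ ⟨u * x * u⁻¹, (Subgroup.mem_normalizer_iff.mp hu x).mp x.2⟩ : P) = v * φ x * v⁻¹}
  one_mem' := ⟨one_mem _, 1, fun x => by simp⟩
  mul_mem' := by
    rintro a b ⟨ha, v, hv⟩ ⟨hb, w, hw⟩
    refine ⟨mul_mem ha hb, v * w, fun x => ?_⟩
    have h := hv ⟨b * x * b⁻¹, (Subgroup.mem_normalizer_iff.mp hb x).mp x.2⟩
    rw [hw x] at h
    simpa [mul_assoc] using h
  inv_mem' := by
    rintro a ⟨ha, v, hv⟩
    refine ⟨inv_mem ha, v⁻¹, fun x => ?_⟩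
    have h := hv ⟨a⁻¹ * x * a⁻¹⁻¹, (Subgroup.mem_normalizer_iff.mp (inv_mem ha) x).mp x.2⟩
    have e : (⟨a * (a⁻¹ * x * a⁻¹⁻¹) * a⁻¹, by simp [mul_assoc]⟩ : Q) = x :=
      Subtype.ext (by simp [mul_assoc])
    rw [e] at h
    rw [h]
    simp [mul_assoc]

theorem le_extender {Q R : Subgroup P} (φ : Q →* R) : Q ≤ extender φ := by
  intro u hu
  refine ⟨Subgroup.le_normalizer hu, φ ⟨u, hu⟩, fun x => ?_⟩
  have e : (⟨u * x * u⁻¹, mul_mem (mul_mem hu x.2) (inv_mem hu)⟩ : Q)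
      = ⟨u, hu⟩ * x * ⟨u, hu⟩⁻¹ := rfl
  rw [e]
  simp

/-- `F` is a saturated fusion system on `P`. -/
structure IsSaturated (p : ℕ) (F : FusionCategory P) : Prop where
  /-- Inclusions are morphisms. -/
  inclusion_mem : ∀ {Q R : Subgroup P} (h : Q ≤ R), Subgroup.inclusion h ∈ F.Hom Q R
  /-- The isomorphism `e : Q → φ(Q)` induced by a morphism `φ`, and its inverse, are morphisms
  (the condition on `e` forces `T = φ(Q)`). -/
  iso_mem : ∀ {Q R : Subgroup P} {φ : Q →* R}, φ ∈ F.Hom Q R →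
    ∀ {T : Subgroup P} (e : Q ≃* T), (∀ x : Q, (e x : P) = φ x) →
      e.toMonoidHom ∈ F.Hom Q T ∧ e.symm.toMonoidHom ∈ F.Hom T Q
  /-- Conjugations by elements of `P` are morphisms. -/
  conj_mem : ∀ Q R : Subgroup P, (trivialFusion P).Hom Q R ⊆ F.Hom Q R
  /-- Sylow axiom. -/
  sylow : ∃ S : Sylow p (F.aut ⊤), (S : Subgroup (F.aut ⊤)) = (autP ⊤).subgroupOf (F.aut ⊤)
  /-- Extension axiom. -/
  extension : ∀ {Q : Subgroup P} {φ : Q →* (⊤ : Subgroup P)}, φ ∈ F.Hom Q ⊤ →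
    F.IsFullyNormalized (image φ) →
      ∃ ψ ∈ F.Hom (extender φ) ⊤, ψ.comp (Subgroup.inclusion (le_extender φ)) = φ

/-- A homomorphism between subgroups of `Q`, read as one between subgroups of `P ≥ Q`. -/
noncomputable def liftHom {Q : Subgroup P} {R T : Subgroup Q} (φ : R →* T) :
    R.map Q.subtype →* T.map Q.subtype :=
  ((T.equivMapOfInjective Q.subtype Q.subtype_injective).toMonoidHom.comp φ).comp
    (R.equivMapOfInjective Q.subtype Q.subtype_injective).symm.toMonoidHom

/-- The full subcategory of `F` whose objects are the subgroups of `Q`. -/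
noncomputable def restrict (F : FusionCategory P) (Q : Subgroup P) : FusionCategory Q where
  Hom R T := {φ | liftHom φ ∈ F.Hom (R.map Q.subtype) (T.map Q.subtype)}
  injective := by
    intro R T φ hφ x y hxy
    have h := F.injective hφ
    apply (R.equivMapOfInjective Q.subtype Q.subtype_injective).injective
    apply h
    simp [liftHom, hxy]
  id_mem R := by
    have h : liftHom (MonoidHom.id R) = MonoidHom.id (R.map Q.subtype) := by
      ext x; simp [liftHom]
    simpa [h] using F.id_mem _
  comp_mem := by
    intro R S T φ ψ hφ hψ
    have h : liftHom (ψ.comp φ) = (liftHom ψ).comp (liftHom φ) := by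
      ext x; simp [liftHom]
    simpa [h] using F.comp_mem hφ hψ

/-- `G`, with objects the subgroups of `Q`, is a subcategory of `F`. -/
def IsSubsystem {Q : Subgroup P} (G : FusionCategory Q) (F : FusionCategory P) : Prop :=
  ∀ R T : Subgroup Q, G.Hom R T ⊆ (F.restrict Q).Hom R T

/-- `G`, with objects the subgroups of `Q`, is a subcategory of `F` different from `F`; it would
equal `F` exactly if `Q = P` and `G` has the same morphisms as `F`. -/
def IsProperSubsystem {Q : Subgroup P} (G : FusionCategory Q) (F : FusionCategory P) : Prop :=
  G.IsSubsystem F ∧ ¬ (Q = ⊤ ∧ G = F.restrict Q)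

/-- A saturated fusion system `F` on `P` is extremely sparse if it is nontrivial and the only proper
(saturated) subsystem of `F` on any subgroup `Q` of `P` is `F_Q(Q)`. -/
def IsExtremelySparse (p : ℕ) (F : FusionCategory P) : Prop :=
  F ≠ trivialFusion P ∧ ∀ (Q : Subgroup P) (G : FusionCategory Q),
    G.IsSaturated p → G.IsProperSubsystem F → G = trivialFusion Q

end FusionCategory

/-! The argument rests on Frobenius' criterion: a saturated fusion system in which every `F.aut Q`
is a `p`-group is trivial. A nontrivial `F` therefore has a subgroup `Q` and some `α` in `F.aut Q`
of prime order `q ≠ p`. Let `A` be cyclic of order `q`, acting on `Q` through `α`. In `Q ⋊ A` the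
subgroup `Q` is normal of index prime to `p`, so its fusion system is saturated; it lies in `F`, and
it is nontrivial because `α`, having order prime to `p`, is not inner. Extreme sparseness leaves
only `Q = P` and equality with `F`.

Essential subgroups are then excluded by normality of `P` in `P ⋊ A`: every `Out_F(Q)` has a normal
Sylow `p`-subgroup, which is incompatible with strong embedding. -/

namespace FusionCategory

variable {P : Type*} [Group P]

/-! ### Automorphisms induced by conjugation -/

section Aut

theorem mem_aut_groupFusion {G : Type*} [Group G] {ι : P →* G} {hι : Function.Injective ι}
    {Q : Subgroup P} {α : MulAut Q} :
    α ∈ (groupFusion ι hι).aut Q ↔ ∃ g : G, ∀ x : Q, ι (α x : P) = g * ι (x : P) * g⁻¹ := by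
  refine ⟨fun h => h.1, fun ⟨g, hg⟩ => ⟨⟨g, hg⟩, g⁻¹, fun x => ?_⟩⟩
  have h := hg (α.symm x)
  rw [MulEquiv.apply_symm_apply] at h
  simp [h, mul_assoc]

theorem mem_autP {Q : Subgroup P} {α : MulAut Q} :
    α ∈ autP Q ↔ ∃ g : P, ∀ x : Q, (α x : P) = g * (x : P) * g⁻¹ :=
  mem_aut_groupFusion

theorem pow_apply_eq_conj {G : Type*} [Group G] {ι : P →* G} {Q : Subgroup P} {α : MulAut Q}
    {g : G} (hg : ∀ x : Q, ι (α x : P) = g * ι (x : P) * g⁻¹) (n : ℕ) (x : Q) :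
    ι ((α ^ n) x : P) = g ^ n * ι (x : P) * (g ^ n)⁻¹ := by
  induction n with
  | zero => simp
  | succ k ih => simp [pow_succ' α, pow_succ' g, MulAut.mul_apply, hg, ih, mul_assoc]

theorem isPGroup_autP {p : ℕ} (hP : IsPGroup p P) (Q : Subgroup P) : IsPGroup p (autP Q) := by
  rintro ⟨α, hα⟩
  obtain ⟨g, hg⟩ := mem_autP.1 hα
  obtain ⟨k, hk⟩ := hP g
  refine ⟨k, Subtype.ext (MulEquiv.ext fun x => Subtype.ext ?_)⟩
  have := pow_apply_eq_conj (ι := MonoidHom.id P) hg (p ^ k) x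
  simpa [hk] using this

end Aut

/-! ### Fusion in a group with a normal Sylow `p`-subgroup -/

section NormalEmbedding

variable {G : Type*} [Group G] {ι : P →* G} {hι : Function.Injective ι}

theorem autP_le_aut_groupFusion (Q : Subgroup P) : autP Q ≤ (groupFusion ι hι).aut Q := by
  intro α hα
  obtain ⟨g, hg⟩ := mem_autP.1 hα
  exact mem_aut_groupFusion.2 ⟨ι g, fun x => by simp [hg]⟩

theorem normal_autP_subgroupOf (hn : ι.range.Normal) (Q : Subgroup P) :
    ((autP Q).subgroupOf ((groupFusion ι hι).aut Q)).Normal := by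
  refine ⟨?_⟩
  rintro ⟨α, hα'⟩ hα ⟨β, hβ⟩
  obtain ⟨u, hu⟩ := mem_autP.1 (Subgroup.mem_subgroupOf.1 hα)
  obtain ⟨g, hg⟩ := mem_aut_groupFusion.1 hβ
  obtain ⟨v, hv⟩ := hn.conj_mem (ι u) ⟨u, rfl⟩ g
  refine Subgroup.mem_subgroupOf.2 (mem_autP.2 ⟨v, fun x => hι ?_⟩)
  have h := hg (β⁻¹ x)
  rw [MulAut.apply_inv_self] at h
  have h2 := hg (α (β⁻¹ x))
  have h3 := hu (β⁻¹ x)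
  simp only at h3
  change ι (β (α (β⁻¹ x)) : P) = _
  rw [h2, h3]
  simp only [map_mul, map_inv, hv, h]
  simp [mul_assoc]

theorem not_dvd_index_autP_subgroupOf [Finite P] {p : ℕ} [Fact p.Prime] (hn : ι.range.Normal)
    (hp : ¬ p ∣ ι.range.index) (Q : Subgroup P) :
    ¬ p ∣ ((autP Q).subgroupOf ((groupFusion ι hι).aut Q)).index := by
  intro hd
  have := normal_autP_subgroupOf (hι := hι) hn Q
  have : Finite (MulAut Q) := DFunLike.finite _
  rw [Subgroup.index_eq_card] at hd
  obtain ⟨x, hx⟩ := exists_prime_orderOf_dvd_card' p hd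
  obtain ⟨⟨β, hβ⟩, rfl⟩ := QuotientGroup.mk_surjective x
  refine hp (hx ▸ orderOf_dvd_of_pow_eq_one ?_)
  rw [← QuotientGroup.mk_pow, QuotientGroup.eq_one_iff]
  obtain ⟨g, hg⟩ := mem_aut_groupFusion.1 hβ
  obtain ⟨v, hv⟩ := Subgroup.pow_index_mem ι.range g
  -- The index of `ι.range` kills the quotient by `Aut_P(Q)`, since that power of `g` lies in
  -- `ι.range`.
  refine Subgroup.mem_subgroupOf.2 (mem_autP.2 ⟨v, fun x => hι ?_⟩)
  have := pow_apply_eq_conj hg ι.range.index x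
  simpa [hv] using this

/-- The normal Sylow `p`-subgroup `Aut_P(Q)` of `Aut_G(Q)`, for a normal Sylow `p`-subgroup `P`
of `G`. -/
theorem exists_sylow_eq_autP [Finite P] {p : ℕ} [Fact p.Prime] (hP : IsPGroup p P)
    (hn : ι.range.Normal) (hp : ¬ p ∣ ι.range.index) (Q : Subgroup P) :
    ∃ S : Sylow p ((groupFusion ι hι).aut Q),
      (S : Subgroup ((groupFusion ι hι).aut Q)) =
        (autP Q).subgroupOf ((groupFusion ι hι).aut Q) :=
  ⟨((isPGroup_autP hP Q).comap_of_injective _ (Subgroup.subtype_injective _)).toSylow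
    (not_dvd_index_autP_subgroupOf hn hp Q), rfl⟩

theorem groupFusion_isSaturated [Finite P] {p : ℕ} [Fact p.Prime] (hP : IsPGroup p P)
    (hn : ι.range.Normal) (hp : ¬ p ∣ ι.range.index) : (groupFusion ι hι).IsSaturated p where
  inclusion_mem h := ⟨1, fun x => by simp⟩
  iso_mem := by
    rintro Q R φ ⟨g, hg⟩ T e he
    refine ⟨⟨g, fun x => by simp [he, hg]⟩, g⁻¹, fun y => ?_⟩
    have h := hg (e.symm y)
    rw [← he, MulEquiv.apply_symm_apply] at h
    simp [h, mul_assoc]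
  conj_mem := by
    rintro Q R φ ⟨g, hg⟩
    exact ⟨ι g, fun x => by simpa using congrArg ι (hg x)⟩
  sylow := exists_sylow_eq_autP hP hn hp ⊤
  extension := by
    rintro Q φ ⟨g, hg⟩ -
    have hr (x : P) : g * ι x * g⁻¹ ∈ ι.range := hn.conj_mem _ ⟨x, rfl⟩ g
    choose c hc using hr
    -- Conjugation by `g` preserves the normal image of `P`, so it is defined on any subgroup.
    let ψ : extender φ →* (⊤ : Subgroup P) :=
      { toFun := fun x => ⟨c x, trivial⟩
        map_one' := Subtype.ext (hι (by simp [hc]))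
        map_mul' := fun x y => Subtype.ext (hι (by simp [hc])) }
    refine ⟨ψ, ⟨g, fun x => hc x⟩, ?_⟩
    ext x
    exact hι ((hc x).trans (hg x).symm)

theorem not_isEssential_groupFusion [Finite P] {p : ℕ} [Fact p.Prime] (hP : IsPGroup p P)
    (hn : ι.range.Normal) (hp : ¬ p ∣ ι.range.index) (Q : Subgroup P) :
    ¬ (groupFusion ι hι).IsEssential p Q := by
  rintro ⟨-, H, hH, S, hS, hSH, hx⟩
  have : Finite (MulAut Q) := DFunLike.finite _
  have hN := normal_autP_subgroupOf (hι := hι) hn Q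
  let π := QuotientGroup.mk' ((innerAut Q).subgroupOf ((groupFusion ι hι).aut Q))
  have hπ : Function.Surjective π := QuotientGroup.mk'_surjective _
  let N := ((autP Q).subgroupOf ((groupFusion ι hι).aut Q)).map π
  have hpN : IsPGroup p N :=
    ((isPGroup_autP hP Q).comap_of_injective _ (Subgroup.subtype_injective _)).map π
  have hiN : ¬ p ∣ N.index := fun h =>
    not_dvd_index_autP_subgroupOf (hι := hι) hn hp Q (h.trans (Subgroup.index_map_dvd _ hπ))
  have hnT : (hpN.toSylow hiN : Subgroup ((groupFusion ι hι).Out Q)).Normal := hN.map π hπ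
  have := Sylow.unique_of_normal _ hnT
  have hnS : (S : Subgroup ((groupFusion ι hι).Out Q)).Normal := by
    rwa [Subsingleton.elim S (hpN.toSylow hiN)]
  obtain ⟨x, hxH⟩ : ∃ x, x ∉ H := by
    by_contra! h
    exact hH ((Subgroup.eq_top_iff' H).2 h)
  refine hS (eq_bot_iff.2 ?_)
  rw [← hx x hxH]
  -- Normality gives `S ^ x = S`, so `S` itself lies in the trivial group `H ⊓ S ^ x`.
  refine le_inf hSH fun y hy => ⟨x * y * x⁻¹, hnS.conj_mem y hy x, ?_⟩
  simp [mul_assoc]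

end NormalEmbedding

/-! ### Saturated systems and Frobenius' criterion -/

section Saturated

variable {p : ℕ} {F : FusionCategory P}

theorem IsSaturated.mem_of_restrict (hF : F.IsSaturated p) {Q R Q' R' : Subgroup P}
    {φ : Q →* R} (hφ : φ ∈ F.Hom Q R) (h : Q' ≤ Q) (f : Q' →* R')
    (hf : ∀ x : Q', (f x : P) = φ ⟨x, h x.2⟩) : f ∈ F.Hom Q' R' := by
  have h1 := F.comp_mem (hF.inclusion_mem h) hφ
  have hinj : Function.Injective f := fun x y hxy =>
    F.injective h1 (Subtype.ext ((hf x).symm.trans ((congrArg Subtype.val hxy).trans (hf y))))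
  have hinj' : Function.Injective (R'.subtype.comp f) := R'.subtype_injective.comp hinj
  have h2 := (hF.iso_mem h1 (MonoidHom.ofInjective hinj') fun x => hf x).1
  have hle : (R'.subtype.comp f).range ≤ R' := by
    rintro _ ⟨x, rfl⟩
    exact (f x).2
  exact F.comp_mem h2 (hF.inclusion_mem hle)

theorem IsSaturated.mem_aut (hF : F.IsSaturated p) {Q : Subgroup P} {α : MulAut Q}
    (h : MulEquiv.toMonoidHom α ∈ F.Hom Q Q) : α ∈ F.aut Q :=
  hF.iso_mem h α fun _ => rfl

theorem IsSaturated.autP_le_aut (hF : F.IsSaturated p) (Q : Subgroup P) : autP Q ≤ F.aut Q :=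
  fun _ hα => ⟨hF.conj_mem _ _ hα.1, hF.conj_mem _ _ hα.2⟩

theorem IsIso.refl (F : FusionCategory P) (Q : Subgroup P) : F.IsIso Q Q :=
  ⟨MulEquiv.refl Q, F.id_mem Q, F.id_mem Q⟩

theorem IsIso.trans {Q R S : Subgroup P} (h : F.IsIso Q R) (h' : F.IsIso R S) : F.IsIso Q S := by
  obtain ⟨e, h1, h2⟩ := h
  obtain ⟨f, h3, h4⟩ := h'
  exact ⟨e.trans f, F.comp_mem h1 h3, F.comp_mem h4 h2⟩

theorem exists_isIso_isFullyNormalized [Finite P] (F : FusionCategory P) (Q : Subgroup P) :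
    ∃ R, F.IsIso Q R ∧ F.IsFullyNormalized R := by
  obtain ⟨R, hR, hmax⟩ := Set.exists_max_image {R | F.IsIso Q R}
    (fun R => Nat.card (Subgroup.normalizer (R : Set P))) (Set.toFinite _) ⟨Q, IsIso.refl F Q⟩
  exact ⟨R, hR, fun S hS => hmax S (hR.trans hS)⟩

theorem lt_normalizer [Finite P] [Fact p.Prime] (hP : IsPGroup p P) {Q : Subgroup P}
    (hQ : Q ≠ ⊤) : Q < Subgroup.normalizer (Q : Set P) :=
  haveI := hP.isNilpotent
  Group.normalizerCondition_of_isNilpotent Q (lt_top_iff_ne_top.2 hQ)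

/-- If `N_φ = N_P(Q)` and morphisms defined on larger subgroups are induced by `P`, so is `φ`. -/
theorem IsSaturated.exists_conj_of_normalizer_le_extender [Finite P] [Fact p.Prime]
    (hP : IsPGroup p P) (hF : F.IsSaturated p) {Q : Subgroup P} (hQ : Q ≠ ⊤)
    (ih : ∀ T : Subgroup P, Nat.card Q < Nat.card T → ∀ φ ∈ F.Hom T ⊤,
      ∃ g : P, ∀ x : T, (φ x : P) = g * x * g⁻¹)
    {φ : Q →* (⊤ : Subgroup P)} (hφ : φ ∈ F.Hom Q ⊤) (hn : F.IsFullyNormalized (image φ))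
    (hle : Subgroup.normalizer (Q : Set P) ≤ extender φ) :
    ∃ g : P, ∀ x : Q, (φ x : P) = g * x * g⁻¹ := by
  obtain ⟨ψ, hψ, hψφ⟩ := hF.extension hφ hn
  have hlt : Nat.card Q < Nat.card (extender φ) :=
    Set.ncard_lt_ncard (lt_of_lt_of_le (lt_normalizer hP hQ) hle)
  obtain ⟨g, hg⟩ := ih _ hlt ψ hψ
  refine ⟨g, fun x => ?_⟩
  rw [← hψφ]
  exact hg _

/-- In a `p`-group a proper subgroup is smaller than its normalizer. An `α` normalizing `Aut_P(Q)`
has `N_α = N_P(Q)`, so it extends beyond `Q` and is induced by `P`; hence `Aut_P(Q)` cannot be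
proper. -/
theorem IsSaturated.aut_le_autP [Finite P] [Fact p.Prime]
    (hP : IsPGroup p P) (hF : F.IsSaturated p) {Q : Subgroup P} (hA : IsPGroup p (F.aut Q))
    (hQ : Q ≠ ⊤) (hn : F.IsFullyNormalized Q)
    (ih : ∀ T : Subgroup P, Nat.card Q < Nat.card T → ∀ φ ∈ F.Hom T ⊤,
      ∃ g : P, ∀ x : T, (φ x : P) = g * x * g⁻¹) : F.aut Q ≤ autP Q := by
  rw [← Subgroup.subgroupOf_eq_top]
  by_contra hne
  have : Finite (MulAut Q) := DFunLike.finite _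
  have := hA.isNilpotent
  obtain ⟨⟨α, hα⟩, hαN, hαB⟩ := SetLike.exists_of_lt
    (Group.normalizerCondition_of_isNilpotent _ (lt_top_iff_ne_top.2 hne))
  refine hαB (Subgroup.mem_subgroupOf.2 (mem_autP.2 ?_))
  have hφ := F.comp_mem hα.1 (hF.inclusion_mem (le_top : Q ≤ ⊤))
  have him : image ((Subgroup.inclusion (le_top : Q ≤ ⊤)).comp (MulEquiv.toMonoidHom α)) = Q := by
    ext y
    constructor
    · rintro ⟨x, rfl⟩
      exact (α x).2
    · intro hy
      exact ⟨α⁻¹ ⟨y, hy⟩, by simp⟩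
  refine hF.exists_conj_of_normalizer_le_extender hP hQ ih hφ (by rwa [him]) fun u hu => ?_
  let c : MulAut Q := MulAut.conjNormal (H := Q.subgroupOf (Subgroup.normalizer (Q : Set P)))
    ⟨u, hu⟩ |> MulAut.congr (Subgroup.subgroupOfEquivOfLe Subgroup.le_normalizer)
  have hc (x : Q) : (c x : P) = u * x * u⁻¹ := rfl
  have hcP : c ∈ autP Q := mem_autP.2 ⟨u, hc⟩
  have h := (Subgroup.mem_normalizer_iff.1 hαN ⟨c, hF.autP_le_aut Q hcP⟩).1 hcP
  obtain ⟨v, hv⟩ := mem_autP.1 (Subgroup.mem_subgroupOf.1 h)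
  refine ⟨hu, v, fun x => ?_⟩
  have := hv (α x)
  change (α (c (α⁻¹ (α x))) : P) = _ at this
  rwa [MulAut.inv_apply_self] at this

/-- Frobenius' criterion: a saturated fusion system all of whose automorphism groups are
`p`-groups is trivial. -/
theorem IsSaturated.exists_conj_of_isPGroup_aut [Finite P] [Fact p.Prime]
    (hP : IsPGroup p P) (hF : F.IsSaturated p) (hA : ∀ Q, IsPGroup p (F.aut Q))
    (Q : Subgroup P) (φ : Q →* (⊤ : Subgroup P)) (hφ : φ ∈ F.Hom Q ⊤) :
    ∃ g : P, ∀ x : Q, (φ x : P) = g * x * g⁻¹ := by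
  -- Descending induction on the order of `Q`; for `Q = P` the Sylow axiom suffices.
  induction hk : Nat.card P - Nat.card Q using Nat.strong_induction_on generalizing Q with
  | _ k IH =>
  by_cases hQ : Q = ⊤
  · subst hQ
    let α : MulAut (⊤ : Subgroup P) :=
      MulEquiv.ofBijective φ (Finite.injective_iff_bijective.1 (F.injective hφ))
    have hα : α ∈ F.aut ⊤ := hF.mem_aut hφ
    obtain ⟨S, hS⟩ := hF.sylow
    have hS' := S.3 (((hA ⊤).to_subgroup ⊤)) le_top
    have : (⟨α, hα⟩ : F.aut ⊤) ∈ (S : Subgroup (F.aut ⊤)) := by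
      rw [← hS']
      trivial
    rw [hS] at this
    exact mem_autP.1 this
  have ih : ∀ T : Subgroup P, Nat.card Q < Nat.card T → ∀ ψ ∈ F.Hom T ⊤,
      ∃ g : P, ∀ x : T, (ψ x : P) = g * x * g⁻¹ := by
    intro T hT ψ hψ
    have := Subgroup.card_le_card_group T
    exact IH _ (by omega) T ψ hψ rfl
  have hcard {T : Subgroup P} (e : Q ≃* T) : Nat.card T = Nat.card Q :=
    (Nat.card_congr e.toEquiv).symm
  have htop {T : Subgroup P} (e : Q ≃* T) : T ≠ ⊤ := fun h =>
    hQ (Subgroup.eq_top_of_card_eq Q (by rw [← hcard e, h, Subgroup.card_top]))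
  obtain ⟨R, ⟨e, he, he'⟩, hR⟩ := exists_isIso_isFullyNormalized F Q
  have haut := hF.aut_le_autP hP (hA R) (htop e) hR (by rwa [hcard e])
  -- As `Aut_F(R) = Aut_P(R)`, each `f ∘ c_u ∘ f⁻¹` is induced by `P`, so `N_f = N_P(T)`.
  have key : ∀ (T : Subgroup P) (_ : Q ≃* T) (f : T ≃* R), f.toMonoidHom ∈ F.Hom T R →
      f.symm.toMonoidHom ∈ F.Hom R T → ∃ g : P, ∀ x : T, (f x : P) = g * x * g⁻¹ := by
    intro T d f hf hf'
    have hfi := F.comp_mem hf (hF.inclusion_mem (le_top : R ≤ ⊤))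
    have him : image ((Subgroup.inclusion (le_top : R ≤ ⊤)).comp f.toMonoidHom) = R := by
      ext y
      constructor
      · rintro ⟨x, rfl⟩
        exact (f x).2
      · intro hy
        exact ⟨f.symm ⟨y, hy⟩, by simp⟩
    refine hF.exists_conj_of_normalizer_le_extender hP (htop d) (by rwa [hcard d]) hfi
      (by rwa [him]) fun u hu => ?_
    let c : MulAut T := MulAut.conjNormal (H := T.subgroupOf (Subgroup.normalizer (T : Set P)))
      ⟨u, hu⟩ |> MulAut.congr (Subgroup.subgroupOfEquivOfLe Subgroup.le_normalizer)
    have hc (x : T) : (c x : P) = u * x * u⁻¹ := rfl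
    have hcF := hF.autP_le_aut T (mem_autP.2 ⟨u, hc⟩)
    have hb : MulAut.congr f c ∈ F.aut R :=
      hF.mem_aut (F.comp_mem (F.comp_mem hf' hcF.1) hf)
    obtain ⟨v, hv⟩ := mem_autP.1 (haut hb)
    refine ⟨hu, v, fun x => ?_⟩
    have := hv (f x)
    change (f (c (f.symm (f x))) : P) = _ at this
    rwa [f.symm_apply_apply] at this
  obtain ⟨g, hg⟩ := key Q (MulEquiv.refl Q) e he he'
  have hinj : Function.Injective ((⊤ : Subgroup P).subtype.comp φ) :=
    (Subgroup.subtype_injective _).comp (F.injective hφ)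
  let d := MonoidHom.ofInjective hinj
  obtain ⟨hd, hd'⟩ := hF.iso_mem hφ d fun x => rfl
  obtain ⟨g', hg'⟩ := key _ d (d.symm.trans e) (F.comp_mem hd' he) (F.comp_mem he' hd)
  -- Both `e` and `e ∘ φ⁻¹` on `φ(Q)` end at the fully normalized `R`; `φ` is their quotient.
  refine ⟨g'⁻¹ * g, fun x => ?_⟩
  have h := hg' (d x)
  have h2 : ((d x : _) : P) = φ x := rfl
  rw [h2] at h
  simp only [MulEquiv.trans_apply, MulEquiv.symm_apply_apply, hg] at h
  have h3 : (φ x : P) = g'⁻¹ * (g' * φ x * g'⁻¹) * g' := by group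
  rw [h3, ← h]
  group

theorem IsSaturated.eq_trivialFusion_of_isPGroup_aut [Finite P] [Fact p.Prime]
    (hP : IsPGroup p P) (hF : F.IsSaturated p) (hA : ∀ Q, IsPGroup p (F.aut Q)) :
    F = trivialFusion P := by
  ext Q R φ
  refine ⟨fun hφ => ?_, fun hφ => hF.conj_mem Q R hφ⟩
  exact hF.exists_conj_of_isPGroup_aut hP hA Q _
    (F.comp_mem hφ (hF.inclusion_mem (le_top : R ≤ ⊤)))

end Saturated

/-! ### Semidirect products as subsystems -/

section Semidirect

variable {A : Type*} [Group A]

theorem mul_inl_mul_inv (φ : A →* MulAut P) (g : P ⋊[φ] A) (x : P) :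
    g * SemidirectProduct.inl x * g⁻¹ =
      SemidirectProduct.inl (g.left * φ g.right x * g.left⁻¹) := by
  ext <;> simp [mul_assoc]

theorem mem_groupFusion_inl {φ : A →* MulAut P} {Q R : Subgroup P} {f : Q →* R} :
    f ∈ (groupFusion (SemidirectProduct.inl : P →* P ⋊[φ] A)
        SemidirectProduct.inl_injective).Hom Q R ↔
      ∃ (n : P) (a : A), ∀ x : Q, (f x : P) = n * φ a x * n⁻¹ := by
  constructor
  · rintro ⟨g, hg⟩
    refine ⟨g.left, g.right, fun x => SemidirectProduct.inl_injective (φ := φ) ?_⟩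
    rw [hg, mul_inl_mul_inv]
  · rintro ⟨n, a, h⟩
    exact ⟨⟨n, a⟩, fun x => by rw [mul_inl_mul_inv, h]⟩

theorem normal_range_inl (φ : A →* MulAut P) :
    (SemidirectProduct.inl : P →* P ⋊[φ] A).range.Normal := by
  rw [SemidirectProduct.range_inl_eq_ker_rightHom]
  infer_instance

theorem index_range_inl (φ : A →* MulAut P) :
    (SemidirectProduct.inl : P →* P ⋊[φ] A).range.index = Nat.card A := by
  rw [SemidirectProduct.range_inl_eq_ker_rightHom, Subgroup.index_ker,
    MonoidHom.range_eq_top.2 SemidirectProduct.rightHom_surjective, Subgroup.card_top]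

theorem liftHom_apply {Q : Subgroup P} {R T : Subgroup Q} (f : R →* T) (x : P)
    (hQ : x ∈ Q) (hR : ⟨x, hQ⟩ ∈ R) (h : x ∈ R.map Q.subtype) :
    (liftHom f ⟨x, h⟩ : P) = ((f ⟨⟨x, hQ⟩, hR⟩ : Q) : P) := by
  have e : (⟨x, h⟩ : R.map Q.subtype) =
      R.equivMapOfInjective Q.subtype Q.subtype_injective ⟨⟨x, hQ⟩, hR⟩ := rfl
  rw [e]
  simp [liftHom]

theorem IsSaturated.groupFusion_isSubsystem {p : ℕ} {F : FusionCategory P}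
    (hF : F.IsSaturated p) {Q : Subgroup P} {φ : A →* MulAut Q} (hφ : ∀ a, φ a ∈ F.aut Q) :
    (groupFusion (SemidirectProduct.inl : Q →* Q ⋊[φ] A)
      SemidirectProduct.inl_injective).IsSubsystem F := by
  intro R T f hf
  obtain ⟨n, a, h⟩ := mem_groupFusion_inl.1 hf
  have hn : MulAut.conj n ∈ F.aut Q := hF.autP_le_aut Q (mem_autP.2 ⟨n, fun x => by simp⟩)
  refine hF.mem_of_restrict (mul_mem hn (hφ a)).1 (Subgroup.map_subtype_le R) _ ?_
  rintro ⟨_, x, hx, rfl⟩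
  have := liftHom_apply f x x.2 hx ⟨x, hx, rfl⟩
  exact this.trans (congrArg Subtype.val (h ⟨x, hx⟩))

/-- Transports the equality from the group `⊤`, where sparseness yields it, to `P` itself. -/
theorem IsSaturated.eq_groupFusion_of_restrict_top {p : ℕ} {F : FusionCategory P}
    (hF : F.IsSaturated p) {φ : A →* MulAut (⊤ : Subgroup P)}
    (h : groupFusion (SemidirectProduct.inl : (⊤ : Subgroup P) →* (⊤ : Subgroup P) ⋊[φ] A)
      SemidirectProduct.inl_injective = F.restrict ⊤) :
    F = groupFusion (SemidirectProduct.inl :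
      P →* P ⋊[(MulAut.congr Subgroup.topEquiv).toMonoidHom.comp φ] A)
      SemidirectProduct.inl_injective := by
  ext Q R f
  have hmem (Q : Subgroup P) (x : P) (hx : x ∈ (Q.subgroupOf ⊤).map (⊤ : Subgroup P).subtype) :
      x ∈ Q := by
    obtain ⟨y, hy, rfl⟩ := hx
    exact hy
  let f' : Q.subgroupOf ⊤ →* R.subgroupOf ⊤ :=
    { toFun := fun x => ⟨⟨f ⟨x, x.2⟩, trivial⟩, (f ⟨x, x.2⟩).2⟩
      map_one' := Subtype.ext (Subtype.ext (congrArg (Subtype.val : R → P) f.map_one))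
      map_mul' := fun x y =>
        Subtype.ext (Subtype.ext (congrArg (Subtype.val : R → P)
          (f.map_mul ⟨x, x.2⟩ ⟨y, y.2⟩))) }
  have hf' : f ∈ F.Hom Q R ↔ f' ∈ (F.restrict ⊤).Hom _ _ := by
    constructor
    · intro hf
      refine hF.mem_of_restrict hf (hmem Q) _ fun x => ?_
      exact liftHom_apply f' x trivial (hmem Q _ x.2) x.2
    · intro hf
      refine hF.mem_of_restrict hf (fun x hx => ⟨⟨x, trivial⟩, hx, rfl⟩) _ fun x => ?_
      exact (liftHom_apply f' x trivial x.2 _).symm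
  rw [hf', ← h, mem_groupFusion_inl, mem_groupFusion_inl]
  constructor
  · rintro ⟨n, a, hn⟩
    exact ⟨n, a, fun x => congrArg Subtype.val (hn ⟨⟨x, trivial⟩, x.2⟩)⟩
  · rintro ⟨n, a, hn⟩
    exact ⟨⟨n, trivial⟩, a, fun x => Subtype.ext (hn ⟨x, x.2⟩)⟩

end Semidirect

/-! ### Elements of order prime to `p` and the main theorem -/

theorem exists_prime_orderOf_of_not_isPGroup {p : ℕ} {G : Type*} [Group G] [Finite G]
    (h : ¬ IsPGroup p G) : ∃ q : ℕ, q.Prime ∧ q ≠ p ∧ ∃ x : G, orderOf x = q := by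
  have hc : ∀ n, Nat.card G ≠ p ^ n := fun n hn => h (IsPGroup.of_card hn)
  obtain ⟨q, hq, hd, hne⟩ : ∃ q : ℕ, q.Prime ∧ q ∣ Nat.card G ∧ q ≠ p := by
    by_contra! hall
    exact hc _ (Nat.eq_prime_pow_of_unique_prime_dvd Nat.card_pos.ne' fun {d} hd hdvd =>
      hall d hd hdvd)
  have := Fact.mk hq
  exact ⟨q, hq, hne, exists_prime_orderOf_dvd_card' q hd⟩

end FusionCategory

theorem exists_cyclic_action {H : Type*} [Group H] {q : ℕ} (x : H) (hx : orderOf x = q) :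
    ∃ φ : Multiplicative (ZMod q) →* H, (∀ a, φ a ∈ Subgroup.zpowers x) ∧ ∃ a, φ a = x := by
  have hc : Nat.card (Subgroup.zpowers x) = q := by rw [Nat.card_zpowers, hx]
  subst hc
  let e := zmodCyclicMulEquiv (G := Subgroup.zpowers x) inferInstance
  exact ⟨(Subgroup.zpowers x).subtype.comp e.toMonoidHom, fun a => (e a).2,
    e.symm ⟨x, Subgroup.mem_zpowers x⟩, by simp⟩

theorem mainTheorem4 (p : ℕ) [Fact p.Prime] {P : Type*} [Group P] [Finite P] (hP : IsPGroup p P)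
    (F : FusionCategory P) (hF : F.IsSaturated p) (hsparse : F.IsExtremelySparse p) :
    (∀ Q : Subgroup P, ¬ F.IsEssential p Q) ∧
    ∃ q : ℕ, q.Prime ∧ q ≠ p ∧ ∃ (A : Type) (_ : Group A) (φ : A →* MulAut P),
      IsCyclic A ∧ Nat.card A = q ∧
      F = groupFusion (SemidirectProduct.inl : P →* P ⋊[φ] A) SemidirectProduct.inl_injective := by
  have hp : p.Prime := Fact.out
  obtain ⟨hne, hsub⟩ := hsparse
  obtain ⟨Q, hQ⟩ : ∃ Q, ¬ IsPGroup p (F.aut Q) := by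
    by_contra! h
    exact hne (hF.eq_trivialFusion_of_isPGroup_aut hP h)
  have : Finite (MulAut Q) := DFunLike.finite _
  obtain ⟨q, hq, hqp, ⟨α, hα⟩, hord⟩ := FusionCategory.exists_prime_orderOf_of_not_isPGroup hQ
  rw [Subgroup.orderOf_mk] at hord
  obtain ⟨φ, hφ, a, ha⟩ := exists_cyclic_action α hord
  have hcard : Nat.card (Multiplicative (ZMod q)) = q := Nat.card_zmod q
  have hdvd : ¬ p ∣ q := fun h => hqp ((Nat.prime_dvd_prime_iff_eq hp hq).1 h).symm
  have hind (N : Type _) [Group N] (θ : Multiplicative (ZMod q) →* MulAut N) :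
      ¬ p ∣ (SemidirectProduct.inl : N →* N ⋊[θ] Multiplicative (ZMod q)).range.index := by
    rwa [FusionCategory.index_range_inl, hcard]
  have hφF (b) : φ b ∈ F.aut Q := (Subgroup.zpowers_le.2 hα) (hφ b)
  let G := groupFusion (SemidirectProduct.inl : Q →* Q ⋊[φ] Multiplicative (ZMod q))
    SemidirectProduct.inl_injective
  have hG : G.IsSaturated p := FusionCategory.groupFusion_isSaturated (hP.to_subgroup Q)
    (FusionCategory.normal_range_inl φ) (hind Q φ)
  have hGne : G ≠ trivialFusion Q := by
    intro h
    let f : (⊤ : Subgroup Q) →* (⊤ : Subgroup Q) :=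
      (Subgroup.topEquiv.trans (MulEquiv.trans α Subgroup.topEquiv.symm)).toMonoidHom
    have hf : f ∈ G.Hom ⊤ ⊤ :=
      FusionCategory.mem_groupFusion_inl.2 ⟨1, a, fun x => by simp [f, ha]⟩
    rw [h] at hf
    obtain ⟨n, hn⟩ := hf
    -- If `α` were inner, its order `q` would divide a power of `p`.
    have hαn : α = MulAut.conj n := MulEquiv.ext fun x => hn ⟨x, trivial⟩
    obtain ⟨k, hk⟩ := (hP.to_subgroup Q) n
    have hdk : q ∣ p ^ k := by
      rw [← hord]
      exact orderOf_dvd_of_pow_eq_one (by rw [hαn, ← map_pow, hk, map_one])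
    exact hqp ((Nat.prime_dvd_prime_iff_eq hq hp).1 (hq.dvd_of_dvd_pow hdk))
  obtain ⟨rfl, hGF⟩ : Q = ⊤ ∧ G = F.restrict Q := by
    by_contra h
    exact hGne (hsub Q G hG ⟨hF.groupFusion_isSubsystem hφF, h⟩)
  have hFG := hF.eq_groupFusion_of_restrict_top hGF
  refine ⟨fun R => ?_, q, hq, hqp, Multiplicative (ZMod q), inferInstance, _, inferInstance,
    hcard, hFG⟩
  rw [hFG]
  exact FusionCategory.not_isEssential_groupFusion hP (FusionCategory.normal_range_inl _)
    (hind P _) R
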